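/- Let $n\ge 1$ and let $M$ be an $n\times n$ real matrix with nonnegative entries. For a permutation $\sigma$ of $\{1,\dots,n\}$, say that $\sigma$ gives a positive diagonal of $M$ if $M_{i,\sigma(i)}>0$ for all $i$; positive diagonals are counted by their permutations. Assume that $M$ has at least one positive diagonal. Put $T^{(0)}=M$ and, for $k\ge 0$, let $L^{(k+1)}$ be obtained from $T^{(k)}$ by dividing each row by its sum, and $T^{(k+1)}$ from $L^{(k+1)}$ by dividing each column by its sum (these are the Bayesian updates $L_{d,h}=T_{d,h}a_h/\sum_{h'}T_{d,h'}a_{h'}$ and $T_{d,h}=L_{d,h}b_d/\sum_{d'}L_{d',h}b_{d'}$ with uniform priors $a_h=b_d=1/n$). Then the limits $L^{(\infty)}=\lim_k L^{(k)}$ and $T^{(\infty)}=\lim_k T^{(k)}$ exist, and with the cooperative index $$\mathrm{CI}(M)=\frac1n\sum_{j=1}^n\sum_{i=1}^n L^{(\infty)}_{i,j}\,T^{(\infty)}_{i,j}$$ the following statements are equivalent: (a) $\mathrm{CI}(M)=1$; (b) $M$ has exactly one positive diagonal; (c) $M$ can be obtained, by permuting rows and permuting columns (independently), from an upper-triangular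 matrix, i.e. a matrix $U$ with $U_{i,i}>0$ for all $i$ and $U_{i,j}=0$ for $i>j$. -/

import Mathlib

open Filter Topology

noncomputable section

namespace CoopInf

variable {D H : Type*} [Fintype D] [Fintype H]

/-- The learner's Bayesian update `P_L(h|d) = P_T(d|h) a(h) / ∑ h', P_T(d|h') a(h')` with prior `a`
on concepts. Rows are indexed by data sets, columns by concepts. A zero row stays zero. -/
def learnerUpdate (a : H → ℝ) (T : Matrix D H ℝ) : Matrix D H ℝ :=
  Matrix.of fun d h => T d h * a h / ∑ h', T d h' * a h'

/-- The teacher's update `P_T(d|h) = P_L(h|d) b(d) / ∑ d', P_L(h|d') b(d')` with prior `b`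
on data sets. A zero column stays zero. -/
def teacherUpdate (b : D → ℝ) (L : Matrix D H ℝ) : Matrix D H ℝ :=
  Matrix.of fun d h => L d h * b d / ∑ d', L d' h * b d'

/-- The uniform prior. -/
def uniformPrior (X : Type*) [Fintype X] : X → ℝ := fun _ => 1 / (Fintype.card X : ℝ)

/-- The teacher's matrices in the fixed-point iteration with uniform priors:
`T⁽⁰⁾ = M` is the initial likelihood, and `T⁽ᵏ⁺¹⁾` is the teacher's update of `L⁽ᵏ⁺¹⁾`,
which is the learner's update of `T⁽ᵏ⁾`. -/
def teacherIter (M : Matrix D H ℝ) : ℕ → Matrix D H ℝ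
  | 0 => M
  | k + 1 => teacherUpdate (uniformPrior D) (learnerUpdate (uniformPrior H) (teacherIter M k))

/-- The learner's matrices in the iteration; `learnerIter M k` is `L⁽ᵏ⁺¹⁾`, obtained from `T⁽ᵏ⁾`. -/
def learnerIter (M : Matrix D H ℝ) (k : ℕ) : Matrix D H ℝ :=
  learnerUpdate (uniformPrior H) (teacherIter M k)

/-- Convergence of the fixed-point iteration: both sequences of matrices have a limit. -/
def IterConverges (M : Matrix D H ℝ) : Prop :=
  (∃ L : Matrix D H ℝ, Tendsto (learnerIter M) atTop (𝓝 L)) ∧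
    ∃ T : Matrix D H ℝ, Tendsto (teacherIter M) atTop (𝓝 T)

/-- The transmission index. -/
def transmissionIndex (L T : Matrix D H ℝ) : ℝ :=
  1 / (Fintype.card H : ℝ) * ∑ h, ∑ d, L d h * T d h

/-- The cooperative index: the transmission index of the two limit matrices
(meaningful when `IterConverges M`). -/
def cooperativeIndex (M : Matrix D H ℝ) : ℝ :=
  transmissionIndex (limUnder atTop (learnerIter M)) (limUnder atTop (teacherIter M))

/-- The permutation `σ` selects a positive diagonal of the square matrix `M`. -/
def IsPositiveDiagonal {n : ℕ} (M : Matrix (Fin n) (Fin n) ℝ) (σ : Equiv.Perm (Fin n)) : Prop :=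
  ∀ i, 0 < M i (σ i)

/-- Zero below the main diagonal and positive on it. -/
def IsPosUpperTriangular {n : ℕ} (U : Matrix (Fin n) (Fin n) ℝ) : Prop :=
  (∀ i, 0 < U i i) ∧ U.IsUpperTriangular

/-- `M` arises from `U` by permuting rows and permuting columns. -/
def IsPermutationOf {n : ℕ} (M U : Matrix (Fin n) (Fin n) ℝ) : Prop :=
  ∃ ρ τ : Equiv.Perm (Fin n), M = U.submatrix ρ τ

end CoopInf

end

/-!
Positive diagonals of `M` are supports of permutation matrices, so `M` dominates a doubly stochastic
matrix in support. For every doubly stochastic `P` whose support lies in that of `M`, the quantity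
`∑ P log T⁽ᵏ⁾` is nondecreasing in `k` (concavity of `log`) and bounded above. One such `P` forces
the row sums of `T⁽ᵏ⁾` to tend to `1`, so every cluster point `A` is doubly stochastic. Taking
`P = A`, the relative entropy of `A` from `T⁽ᵏ⁾` is nonincreasing and tends to `0` along a
subsequence, so both sequences converge to `A`. The same monotonicity bounds the entries of `T⁽ᵏ⁾`
away from `0` wherever some `P` is positive, so `A` and `M` have the same positive diagonals.

The cooperative index is thus the mean over the columns of `∑ᵢ Aᵢⱼ²`, which is `1` exactly when `A`
is a permutation matrix, and by Birkhoff's theorem exactly when `A`, equivalently `M`, has a single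
positive diagonal. Given a positive diagonal `σ` of `M`, another one exists exactly when the
relation `0 < M i (σ j)` on pairs `i ≠ j` has a cycle; without cycles it extends to a linear order,
and in that order `M` is upper triangular.
-/

namespace CoopInf

open scoped Matrix

theorem nonempty_periodicPts {α : Type*} [Finite α] [Nonempty α] (f : α → α) :
    (Function.periodicPts f).Nonempty := by
  obtain ⟨x⟩ := ‹Nonempty α›
  obtain ⟨m, k, hne, heq⟩ := Finite.exists_ne_map_eq_of_infinite (fun m => f^[m] x)
  wlog hlt : m < k generalizing m k
  · exact this k m hne.symm heq.symm (by omega)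
  refine ⟨f^[m] x, Function.mk_mem_periodicPts (n := k - m) (by omega) ?_⟩
  rw [Function.IsPeriodicPt, Function.IsFixedPt, ← Function.iterate_add_apply,
    Nat.sub_add_cancel hlt.le]
  exact heq.symm

theorem exists_perm_forall_eq_apply_or_eq_self {α : Type*} [Finite α] [Nonempty α] (f : α → α) :
    ∃ π : Equiv.Perm α, (∀ x, π x = f x ∨ π x = x) ∧ ∃ x, π x = f x := by
  classical
  -- `f` permutes its periodic points; `π` is this permutation, extended by the identity.
  let π : Equiv.Perm α :=
    Equiv.Perm.ofSubtype (p := (· ∈ Function.periodicPts f))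
      ((Function.bijOn_periodicPts f).equiv f)
  have hπ : ∀ x ∈ Function.periodicPts f, π x = f x := fun x hx =>
    Equiv.Perm.ofSubtype_apply_of_mem _ hx
  refine ⟨π, fun x => ?_, (nonempty_periodicPts f).imp hπ⟩
  by_cases hx : x ∈ Function.periodicPts f
  · exact Or.inl (hπ x hx)
  · exact Or.inr (Equiv.Perm.ofSubtype_apply_of_not_mem _ hx)

theorem wellFounded_of_forall_perm_eq_one {α : Type*} [Finite α] {r : α → α → Prop}
    (hr : ∀ x, r x x) (h : ∀ π : Equiv.Perm α, (∀ x, r x (π x)) → π = 1) :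
    WellFounded fun x y => r x y ∧ x ≠ y := by
  classical
  rw [WellFounded.wellFounded_iff_has_min]
  intro S hS
  have : Nonempty S := hS.to_subtype
  by_contra! hmin
  -- Moving every point of `S` to a predecessor, some points of `S` run through a cycle.
  choose f hfS hfr hne using fun y : S => hmin y y.2
  obtain ⟨π, hπ, x, hx⟩ := exists_perm_forall_eq_apply_or_eq_self fun y : S => (⟨f y, hfS y⟩ : S)
  let ρ : Equiv.Perm α := Equiv.Perm.ofSubtype π
  have hρ : ∀ y, r (ρ y) y := by
    intro y
    by_cases hy : y ∈ S
    · rw [show ρ y = π ⟨y, hy⟩ from Equiv.Perm.ofSubtype_apply_of_mem π hy]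
      rcases hπ ⟨y, hy⟩ with hf | hid
      · exact hf ▸ hfr ⟨y, hy⟩
      · rw [hid]
        exact hr y
    · rw [show ρ y = y from Equiv.Perm.ofSubtype_apply_of_not_mem π hy]
      exact hr y
  have hρ_one : ρ = 1 := inv_eq_one.mp (h ρ⁻¹ fun y => by simpa using hρ (ρ⁻¹ y))
  have hπ_one : π = 1 := Equiv.Perm.ofSubtype_injective (hρ_one.trans (map_one _).symm)
  exact hne x (congrArg Subtype.val (hx.symm.trans (by rw [hπ_one]; rfl)))

theorem exists_equiv_fin_lt_of_wellFounded {α : Type*} [Fintype α] {n : ℕ}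
    (hn : Fintype.card α = n) {r : α → α → Prop} (hr : WellFounded r) :
    ∃ e : α ≃ Fin n, ∀ x y, r x y → e x < e y := by
  classical
  have : IsWellFounded α r := ⟨hr⟩
  obtain ⟨s, hrs, hs⟩ := IsWellFounded.exists_well_order_ge r
  let _ : LinearOrder α := linearOrderOfSTO s
  exact ⟨(Fintype.orderIsoFinOfCardEq α hn).symm.toEquiv, fun x y hxy =>
    (Fintype.orderIsoFinOfCardEq α hn).symm.lt_iff_lt.mpr (hrs x y hxy)⟩

theorem perm_eq_one_of_forall_le_apply {α : Type*} [PartialOrder α] [Finite α]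
    {π : Equiv.Perm α} (h : ∀ x, x ≤ π x) : π = 1 := by
  have hiter : ∀ m x, x ≤ (π ^ m) x := by
    intro m x
    induction m with
    | zero => rfl
    | succ m ih => exact ih.trans (by rw [pow_succ']; exact h _)
  ext x
  refine le_antisymm ?_ (h x)
  calc π x ≤ (π ^ (orderOf π - 1)) (π x) := hiter _ _
    _ = x := by
      rw [← Equiv.Perm.mul_apply, pow_sub_one_mul (orderOf_pos π).ne', pow_orderOf_eq_one]; rfl

section Diagonals

variable {n : ℕ} {M U : Matrix (Fin n) (Fin n) ℝ}

theorem exists_isPermutationOf_isPosUpperTriangular (hM : ∀ i j, 0 ≤ M i j)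
    (h : ∃! σ : Equiv.Perm (Fin n), IsPositiveDiagonal M σ) :
    ∃ U : Matrix (Fin n) (Fin n) ℝ, IsPosUpperTriangular U ∧ IsPermutationOf M U := by
  obtain ⟨σ, hσ, huniq⟩ := h
  have hid : ∀ π : Equiv.Perm (Fin n), (∀ i, 0 < M i (σ (π i))) → π = 1 := fun π hπ =>
    mul_eq_left.mp (huniq (σ * π) hπ)
  obtain ⟨e, he⟩ := exists_equiv_fin_lt_of_wellFounded (Fintype.card_fin n)
    (wellFounded_of_forall_perm_eq_one (r := fun i j => 0 < M i (σ j)) hσ hid)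
  refine ⟨M.submatrix e.symm (σ ∘ e.symm), ⟨fun i => hσ _, fun a b hba => ?_⟩, e, e * σ⁻¹, ?_⟩
  · by_contra hne
    have hlt := he (e.symm a) (e.symm b)
      ⟨lt_of_le_of_ne (hM _ _) (Ne.symm hne), e.symm.injective.ne (ne_of_gt hba)⟩
    rw [e.apply_symm_apply, e.apply_symm_apply] at hlt
    exact hlt.asymm hba
  · ext i j
    simp

theorem IsPosUpperTriangular.eq_one_of_isPositiveDiagonal (hU : IsPosUpperTriangular U)
    {π : Equiv.Perm (Fin n)} (hπ : IsPositiveDiagonal U π) : π = 1 :=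
  perm_eq_one_of_forall_le_apply fun i => not_lt.mp fun hlt => (hπ i).ne' (hU.2 hlt)

theorem IsPosUpperTriangular.existsUnique_isPositiveDiagonal (hU : IsPosUpperTriangular U)
    (hMU : IsPermutationOf M U) : ∃! σ : Equiv.Perm (Fin n), IsPositiveDiagonal M σ := by
  obtain ⟨ρ, τ, rfl⟩ := hMU
  refine ⟨τ⁻¹ * ρ, fun i => by simpa using hU.1 (ρ i), fun σ hσ => ?_⟩
  have hone : τ * σ * ρ⁻¹ = 1 :=
    hU.eq_one_of_isPositiveDiagonal fun i => by simpa using hσ (ρ⁻¹ i)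
  rw [← mul_inv_eq_one.mp hone, inv_mul_cancel_left]

end Diagonals

section Updates

variable {D H : Type*} {A : Matrix D H ℝ}

theorem learnerUpdate_uniformPrior_apply [Fintype H] (A : Matrix D H ℝ) (d : D) (h : H) :
    learnerUpdate (uniformPrior H) A d h = A d h / ∑ h', A d h' := by
  have : Nonempty H := ⟨h⟩
  simp only [learnerUpdate, uniformPrior, Matrix.of_apply, ← Finset.sum_mul]
  exact mul_div_mul_right _ _ (one_div_ne_zero (Nat.cast_ne_zero.mpr Fintype.card_ne_zero))

theorem teacherUpdate_eq_transpose [Fintype D] (b : D → ℝ) (A : Matrix D H ℝ) :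
    teacherUpdate b A = (learnerUpdate b Aᵀ)ᵀ := rfl

theorem sum_learnerUpdate_row [Fintype H] {d : D} (hd : ∑ h, A d h ≠ 0) :
    ∑ h, learnerUpdate (uniformPrior H) A d h = 1 := by
  simp only [learnerUpdate_uniformPrior_apply, ← Finset.sum_div, div_self hd]

theorem sum_teacherUpdate_col [Fintype D] {h : H} (hh : ∑ d, A d h ≠ 0) :
    ∑ d, teacherUpdate (uniformPrior D) A d h = 1 :=
  sum_learnerUpdate_row (A := Aᵀ) hh

theorem learnerUpdate_uniformPrior_eq_zero_iff [Fintype H] {d : D} (hd : ∑ h, A d h ≠ 0) (h : H) :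
    learnerUpdate (uniformPrior H) A d h = 0 ↔ A d h = 0 := by
  rw [learnerUpdate_uniformPrior_apply, div_eq_zero_iff, or_iff_left hd]

theorem teacherUpdate_uniformPrior_eq_zero_iff [Fintype D] {h : H} (hh : ∑ d, A d h ≠ 0) (d : D) :
    teacherUpdate (uniformPrior D) A d h = 0 ↔ A d h = 0 :=
  learnerUpdate_uniformPrior_eq_zero_iff (A := Aᵀ) hh d

variable [Fintype D] [Fintype H]

/-- A nonnegative matrix without zero rows or columns. On these matrices neither update divides
by zero, and both updates preserve the class. -/
structure HasPosMarginals (A : Matrix D H ℝ) : Prop where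
  nonneg : ∀ d h, 0 ≤ A d h
  row_sum_pos : ∀ d, 0 < ∑ h, A d h
  col_sum_pos : ∀ h, 0 < ∑ d, A d h

namespace HasPosMarginals

theorem transpose (hA : HasPosMarginals A) : HasPosMarginals Aᵀ :=
  ⟨fun h d => hA.nonneg d h, hA.col_sum_pos, hA.row_sum_pos⟩

theorem row_sum_ne_zero (hA : HasPosMarginals A) (d : D) : ∑ h, A d h ≠ 0 :=
  (hA.row_sum_pos d).ne'

theorem col_sum_ne_zero (hA : HasPosMarginals A) (h : H) : ∑ d, A d h ≠ 0 :=
  (hA.col_sum_pos h).ne'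

theorem learnerUpdate (hA : HasPosMarginals A) :
    HasPosMarginals (learnerUpdate (uniformPrior H) A) where
  nonneg d h := by
    rw [learnerUpdate_uniformPrior_apply]
    exact div_nonneg (hA.nonneg d h) (hA.row_sum_pos d).le
  row_sum_pos d := by
    rw [sum_learnerUpdate_row (hA.row_sum_ne_zero d)]
    exact one_pos
  col_sum_pos h := by
    simp only [learnerUpdate_uniformPrior_apply]
    obtain ⟨d, -, hd⟩ :=
      (Finset.sum_pos_iff_of_nonneg fun d _ => hA.nonneg d h).mp (hA.col_sum_pos h)
    exact Finset.sum_pos' (fun d _ => div_nonneg (hA.nonneg d h) (hA.row_sum_pos d).le)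
      ⟨d, Finset.mem_univ d, div_pos hd (hA.row_sum_pos d)⟩

theorem teacherUpdate (hA : HasPosMarginals A) :
    HasPosMarginals (teacherUpdate (uniformPrior D) A) :=
  hA.transpose.learnerUpdate.transpose

theorem teacherIter (hA : HasPosMarginals A) (k : ℕ) : HasPosMarginals (teacherIter A k) := by
  induction k with
  | zero => exact hA
  | succ k ih => exact ih.learnerUpdate.teacherUpdate

theorem teacherIter_eq_zero_iff (hA : HasPosMarginals A) (k : ℕ) (d : D) (h : H) :
    CoopInf.teacherIter A k d h = 0 ↔ A d h = 0 := by
  induction k with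
  | zero => rfl
  | succ k ih =>
    have hT := hA.teacherIter k
    rw [CoopInf.teacherIter, teacherUpdate_uniformPrior_eq_zero_iff
      (hT.learnerUpdate.col_sum_ne_zero h), learnerUpdate_uniformPrior_eq_zero_iff
      (hT.row_sum_ne_zero d), ih]

theorem sum_teacherIter_succ_col (hA : HasPosMarginals A) (k : ℕ) (h : H) :
    ∑ d, CoopInf.teacherIter A (k + 1) d h = 1 :=
  sum_teacherUpdate_col ((hA.teacherIter k).learnerUpdate.col_sum_ne_zero h)

theorem sum_sum_teacherIter_succ (hA : HasPosMarginals A) (k : ℕ) :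
    ∑ d, ∑ h, CoopInf.teacherIter A (k + 1) d h = Fintype.card H := by
  calc ∑ d, ∑ h, CoopInf.teacherIter A (k + 1) d h
      = ∑ h, ∑ d, CoopInf.teacherIter A (k + 1) d h := Finset.sum_comm
    _ = Fintype.card H := by simp [hA.sum_teacherIter_succ_col]

theorem teacherIter_succ_mem_Icc (hA : HasPosMarginals A) (k : ℕ) (d : D) (h : H) :
    CoopInf.teacherIter A (k + 1) d h ∈ Set.Icc (0 : ℝ) 1 := by
  refine ⟨(hA.teacherIter (k + 1)).nonneg d h, ?_⟩
  rw [← hA.sum_teacherIter_succ_col k h]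
  exact Finset.single_le_sum (f := fun d => CoopInf.teacherIter A (k + 1) d h)
    (fun d _ => (hA.teacherIter (k + 1)).nonneg d h) (Finset.mem_univ d)

theorem eq_zero_of_tendsto_teacherIter (hA : HasPosMarginals A) {κ : Type*} {l : Filter κ}
    [l.NeBot] {φ : κ → ℕ} {B : Matrix D H ℝ}
    (hlim : Tendsto (fun k => CoopInf.teacherIter A (φ k)) l (𝓝 B)) {d : D} {h : H}
    (hdh : A d h = 0) : B d h = 0 := by
  refine tendsto_nhds_unique ((hlim.apply_nhds d).apply_nhds h) ?_
  simp only [(hA.teacherIter_eq_zero_iff _ d h).mpr hdh, tendsto_const_nhds]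

end HasPosMarginals

theorem tendsto_learnerIter_of_tendsto_teacherIter {M : Matrix D H ℝ}
    (hA : ∀ d, ∑ h, A d h = 1)
    (hlim : Tendsto (teacherIter M) atTop (𝓝 A)) :
    Tendsto (learnerIter M) atTop (𝓝 A) := by
  refine tendsto_pi_nhds.mpr fun d => tendsto_pi_nhds.mpr fun h => ?_
  have hentry := fun h => (hlim.apply_nhds d).apply_nhds h
  have hrow : Tendsto (fun k => ∑ h, teacherIter M k d h) atTop (𝓝 1) :=
    hA d ▸ tendsto_finsetSum _ fun h _ => hentry h
  simpa only [learnerIter, learnerUpdate_uniformPrior_apply, div_one, Pi.div_def] using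
    (hentry h).div hrow one_ne_zero

end Updates

section RelativeEntropy

/-- The pairing `∑ P log A`: up to the term `∑ P log P`, which does not depend on `A`, it is minus
the relative entropy of `P` from `A`, and it is the Lyapunov function of the iteration. Since
`Real.log 0 = 0`, it has this meaning only where `P` vanishes at all zeros of `A`. -/
noncomputable def logPairing {D H : Type*} [Fintype D] [Fintype H] (P A : Matrix D H ℝ) : ℝ :=
  ∑ d, ∑ h, P d h * Real.log (A d h)

variable {D H : Type*} [Fintype D] [Fintype H] {P A : Matrix D H ℝ}

theorem logPairing_transpose (P A : Matrix D H ℝ) : logPairing Pᵀ Aᵀ = logPairing P A :=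
  Finset.sum_comm

theorem logPairing_learnerUpdate (hA : ∀ d, ∑ h, A d h ≠ 0) (hP : ∀ d, ∑ h, P d h = 1)
    (hPA : ∀ d h, A d h = 0 → P d h = 0) :
    logPairing P (learnerUpdate (uniformPrior H) A) =
      logPairing P A - ∑ d, Real.log (∑ h, A d h) := by
  have hterm : ∀ d h, P d h * Real.log (learnerUpdate (uniformPrior H) A d h) =
      P d h * Real.log (A d h) - P d h * Real.log (∑ h', A d h') := by
    intro d h
    rcases eq_or_ne (A d h) 0 with h0 | h0
    · simp only [hPA d h h0, zero_mul, sub_zero]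
    · rw [learnerUpdate_uniformPrior_apply, Real.log_div h0 (hA d), mul_sub]
  simp only [logPairing, hterm, Finset.sum_sub_distrib, ← Finset.sum_mul, hP, one_mul]

theorem logPairing_teacherUpdate (hA : ∀ h, ∑ d, A d h ≠ 0) (hP : ∀ h, ∑ d, P d h = 1)
    (hPA : ∀ d h, A d h = 0 → P d h = 0) :
    logPairing P (teacherUpdate (uniformPrior D) A) =
      logPairing P A - ∑ h, Real.log (∑ d, A d h) := by
  rw [teacherUpdate_eq_transpose, ← logPairing_transpose P, ← logPairing_transpose P]
  exact logPairing_learnerUpdate hA hP fun h d => hPA d h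

theorem mul_log_nonpos {p a : ℝ} (hp : 0 ≤ p) (ha : a ∈ Set.Icc (0 : ℝ) 1) :
    p * Real.log a ≤ 0 :=
  mul_nonpos_of_nonneg_of_nonpos hp (Real.log_nonpos ha.1 ha.2)

theorem logPairing_nonpos (hP : ∀ d h, 0 ≤ P d h) (hA : ∀ d h, A d h ∈ Set.Icc (0 : ℝ) 1) :
    logPairing P A ≤ 0 :=
  Finset.sum_nonpos fun d _ => Finset.sum_nonpos fun h _ => mul_log_nonpos (hP d h) (hA d h)

theorem logPairing_le_mul_log (hP : ∀ d h, 0 ≤ P d h) (hA : ∀ d h, A d h ∈ Set.Icc (0 : ℝ) 1)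
    (d : D) (h : H) : logPairing P A ≤ P d h * Real.log (A d h) := by
  have hterm : ∀ x : D × H, P x.1 x.2 * Real.log (A x.1 x.2) ≤ 0 := fun x =>
    mul_log_nonpos (hP x.1 x.2) (hA x.1 x.2)
  calc logPairing P A = ∑ x : D × H, P x.1 x.2 * Real.log (A x.1 x.2) :=
        by rw [logPairing, Fintype.sum_prod_type]
    _ ≤ ∑ x ∈ {(d, h)}, P x.1 x.2 * Real.log (A x.1 x.2) :=
        Finset.sum_le_sum_of_subset_of_nonpos' (Finset.subset_univ _) fun x _ _ => hterm x
    _ = P d h * Real.log (A d h) := Finset.sum_singleton _ _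

theorem sum_log_nonpos {ι : Type*} [Fintype ι] {a : ι → ℝ} (ha : ∀ i, 0 < a i)
    (hsum : ∑ i, a i = Fintype.card ι) : ∑ i, Real.log (a i) ≤ 0 := by
  calc ∑ i, Real.log (a i) ≤ ∑ i, (a i - 1) :=
        Finset.sum_le_sum fun i _ => Real.log_le_sub_one_of_pos (ha i)
    _ = 0 := by simp [hsum]

theorem sq_sqrt_sub_sqrt_le {p a : ℝ} (hp : 0 ≤ p) (ha : 0 ≤ a) (hpa : a = 0 → p = 0) :
    (√p - √a) ^ 2 ≤ p * Real.log p - p * Real.log a + (a - p) := by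
  rcases hp.eq_or_lt with rfl | hp
  · simp [ha]
  have ha : 0 < a := ha.lt_of_ne' fun h0 => hp.ne' (hpa h0)
  -- `log x ≤ x - 1` at `x = √(a / p)`
  have hlog : Real.log a / 2 - Real.log p / 2 ≤ √a / √p - 1 := by
    rw [← Real.log_sqrt ha.le, ← Real.log_sqrt hp.le,
      ← Real.log_div (Real.sqrt_pos.mpr ha).ne' (Real.sqrt_pos.mpr hp).ne']
    exact Real.log_le_sub_one_of_pos (div_pos (Real.sqrt_pos.mpr ha) (Real.sqrt_pos.mpr hp))
  have hmul : p * (√a / √p - 1) = √p * √a - p := by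
    rw [mul_sub, mul_one, mul_div_left_comm, Real.div_sqrt, mul_comm]
  have hscaled := mul_le_mul_of_nonneg_left hlog hp.le
  rw [hmul] at hscaled
  rw [sub_sq, Real.sq_sqrt hp.le, Real.sq_sqrt ha.le]
  linarith

theorem sum_sq_sqrt_sub_sqrt_le {ι : Type*} [Fintype ι] {p a : ι → ℝ} (hp : ∀ i, 0 ≤ p i)
    (ha : ∀ i, 0 ≤ a i) (hpa : ∀ i, a i = 0 → p i = 0) (hsum : ∑ i, a i = ∑ i, p i) :
    ∑ i, (√(p i) - √(a i)) ^ 2 ≤ ∑ i, p i * Real.log (p i) - ∑ i, p i * Real.log (a i) := by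
  calc ∑ i, (√(p i) - √(a i)) ^ 2
      ≤ ∑ i, (p i * Real.log (p i) - p i * Real.log (a i) + (a i - p i)) :=
        Finset.sum_le_sum fun i _ => sq_sqrt_sub_sqrt_le (hp i) (ha i) (hpa i)
    _ = ∑ i, p i * Real.log (p i) - ∑ i, p i * Real.log (a i) := by
        simp only [Finset.sum_add_distrib, Finset.sum_sub_distrib, hsum, sub_self, add_zero]

theorem tendsto_of_tendsto_sum_mul_log {ι κ : Type*} [Fintype ι] {l : Filter κ} {p : ι → ℝ}
    {a : κ → ι → ℝ} (hp : ∀ i, 0 ≤ p i) (ha : ∀ k i, 0 ≤ a k i)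
    (hpa : ∀ k i, a k i = 0 → p i = 0) (hsum : ∀ k, ∑ i, a k i = ∑ i, p i)
    (hlim : Tendsto (fun k => ∑ i, p i * Real.log (a k i)) l (𝓝 (∑ i, p i * Real.log (p i)))) :
    Tendsto a l (𝓝 p) := by
  refine tendsto_pi_nhds.mpr fun i => ?_
  have hentropy : Tendsto (fun k => ∑ i, p i * Real.log (p i) - ∑ i, p i * Real.log (a k i)) l
      (𝓝 0) := by
    simpa only [sub_self] using hlim.const_sub (∑ i, p i * Real.log (p i))
  have hsq : Tendsto (fun k => (√(p i) - √(a k i)) ^ 2) l (𝓝 0) :=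
    squeeze_zero (fun k => sq_nonneg _) (fun k =>
      (Finset.single_le_sum (f := fun i => (√(p i) - √(a k i)) ^ 2)
        (fun i _ => sq_nonneg _) (Finset.mem_univ i)).trans
      (sum_sq_sqrt_sub_sqrt_le hp (ha k) (hpa k) (hsum k))) hentropy
  have hsub : Tendsto (fun k => √(p i) - √(a k i)) l (𝓝 0) := by
    rw [tendsto_zero_iff_abs_tendsto_zero]
    simpa only [Function.comp_def, Real.sqrt_sq_eq_abs, Real.sqrt_zero] using hsq.sqrt
  have hsqrt : Tendsto (fun k => √(a k i)) l (𝓝 √(p i)) := by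
    simpa only [sub_sub_cancel, sub_zero] using hsub.const_sub √(p i)
  simpa only [Real.sq_sqrt, hp, ha] using hsqrt.pow 2

theorem tendsto_of_tendsto_logPairing {κ : Type*} {l : Filter κ} {B : κ → Matrix D H ℝ}
    (hP : ∀ d h, 0 ≤ P d h) (hB : ∀ k d h, 0 ≤ B k d h) (hPB : ∀ k d h, B k d h = 0 → P d h = 0)
    (hsum : ∀ k, ∑ d, ∑ h, B k d h = ∑ d, ∑ h, P d h)
    (hlim : Tendsto (fun k => logPairing P (B k)) l (𝓝 (logPairing P P))) :
    Tendsto B l (𝓝 P) := by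
  have hprod : Tendsto (fun k (x : D × H) => B k x.1 x.2) l (𝓝 fun x => P x.1 x.2) := by
    refine tendsto_of_tendsto_sum_mul_log (fun x => hP x.1 x.2) (fun k x => hB k x.1 x.2)
      (fun k x => hPB k x.1 x.2) (fun k => ?_) ?_
    · simpa only [Fintype.sum_prod_type] using hsum k
    · simpa only [logPairing, Fintype.sum_prod_type] using hlim
  exact tendsto_pi_nhds.mpr fun d => tendsto_pi_nhds.mpr fun h => tendsto_pi_nhds.mp hprod (d, h)

end RelativeEntropy

section Convergence

variable {ι : Type*} [Fintype ι] {A M P : Matrix ι ι ℝ}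

theorem sum_log_row_teacherIter_succ_nonpos (hM : HasPosMarginals M) (k : ℕ) :
    ∑ i, Real.log (∑ j, teacherIter M (k + 1) i j) ≤ 0 :=
  sum_log_nonpos (hM.teacherIter (k + 1)).row_sum_pos (hM.sum_sum_teacherIter_succ k)

variable [DecidableEq ι]

theorem HasPosMarginals.of_mem_doublyStochastic (hM : ∀ i j, 0 ≤ M i j)
    (hP : P ∈ doublyStochastic ℝ ι) (hPM : ∀ i j, M i j = 0 → P i j = 0) :
    HasPosMarginals M where
  nonneg := hM
  row_sum_pos i := by
    obtain ⟨j, -, hj⟩ := Finset.exists_ne_zero_of_sum_ne_zero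
      ((sum_row_of_mem_doublyStochastic hP i).trans_ne one_ne_zero)
    exact Finset.sum_pos' (fun j _ => hM i j)
      ⟨j, Finset.mem_univ j, (hM i j).lt_of_ne' (mt (hPM i j) hj)⟩
  col_sum_pos j := by
    obtain ⟨i, -, hi⟩ := Finset.exists_ne_zero_of_sum_ne_zero
      ((sum_col_of_mem_doublyStochastic hP j).trans_ne one_ne_zero)
    exact Finset.sum_pos' (fun i _ => hM i j)
      ⟨i, Finset.mem_univ i, (hM i j).lt_of_ne' (mt (hPM i j) hi)⟩

theorem logPairing_sub_sum_log_row_le (hA : HasPosMarginals A) (hP : P ∈ doublyStochastic ℝ ι)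
    (hPA : ∀ i j, A i j = 0 → P i j = 0) :
    logPairing P A - ∑ i, Real.log (∑ j, A i j) ≤
      logPairing P (teacherUpdate (uniformPrior ι) (learnerUpdate (uniformPrior ι) A)) := by
  have hL := hA.learnerUpdate
  have htotal : ∑ j, ∑ i, learnerUpdate (uniformPrior ι) A i j = Fintype.card ι := by
    rw [Finset.sum_comm]
    simp [sum_learnerUpdate_row (hA.row_sum_ne_zero _)]
  have hcol : ∑ j, Real.log (∑ i, learnerUpdate (uniformPrior ι) A i j) ≤ 0 :=
    sum_log_nonpos hL.col_sum_pos htotal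
  rw [logPairing_teacherUpdate hL.col_sum_ne_zero (sum_col_of_mem_doublyStochastic hP)
      fun i j h => hPA i j ((learnerUpdate_uniformPrior_eq_zero_iff (hA.row_sum_ne_zero i) j).mp h),
    logPairing_learnerUpdate hA.row_sum_ne_zero (sum_row_of_mem_doublyStochastic hP) hPA]
  linarith

theorem logPairing_teacherIter_succ_sub_le (hM : HasPosMarginals M)
    (hP : P ∈ doublyStochastic ℝ ι) (hPM : ∀ i j, M i j = 0 → P i j = 0) (k : ℕ) :
    logPairing P (teacherIter M (k + 1)) - ∑ i, Real.log (∑ j, teacherIter M (k + 1) i j) ≤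
      logPairing P (teacherIter M (k + 2)) :=
  logPairing_sub_sum_log_row_le (hM.teacherIter (k + 1)) hP fun i j h =>
    hPM i j ((hM.teacherIter_eq_zero_iff (k + 1) i j).mp h)

theorem monotone_logPairing_teacherIter_succ (hM : HasPosMarginals M)
    (hP : P ∈ doublyStochastic ℝ ι) (hPM : ∀ i j, M i j = 0 → P i j = 0) :
    Monotone fun k => logPairing P (teacherIter M (k + 1)) :=
  monotone_nat_of_le_succ fun k =>
    (le_sub_self_iff _ |>.mpr (sum_log_row_teacherIter_succ_nonpos hM k)).trans
      (logPairing_teacherIter_succ_sub_le hM hP hPM k)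

theorem tendsto_sum_log_row_teacherIter_succ (hM : HasPosMarginals M)
    (hP : P ∈ doublyStochastic ℝ ι) (hPM : ∀ i j, M i j = 0 → P i j = 0) :
    Tendsto (fun k => ∑ i, Real.log (∑ j, teacherIter M (k + 1) i j)) atTop (𝓝 0) := by
  have hbdd : BddAbove (Set.range fun k => logPairing P (teacherIter M (k + 1))) :=
    ⟨0, Set.forall_mem_range.mpr fun k => logPairing_nonpos
      (fun _ _ => nonneg_of_mem_doublyStochastic hP) (hM.teacherIter_succ_mem_Icc k)⟩
  have hlim := tendsto_atTop_ciSup (monotone_logPairing_teacherIter_succ hM hP hPM) hbdd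
  have hdiff := hlim.sub (hlim.comp (tendsto_add_atTop_nat 1))
  rw [sub_self] at hdiff
  exact tendsto_of_tendsto_of_tendsto_of_le_of_le hdiff tendsto_const_nhds
    (fun k => sub_le_comm.mp (logPairing_teacherIter_succ_sub_le hM hP hPM k))
    (sum_log_row_teacherIter_succ_nonpos hM)

theorem tendsto_row_sum_teacherIter_succ (hM : HasPosMarginals M)
    (hP : P ∈ doublyStochastic ℝ ι) (hPM : ∀ i j, M i j = 0 → P i j = 0) :
    Tendsto (fun k i => ∑ j, teacherIter M (k + 1) i j) atTop (𝓝 1) := by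
  have hT := fun k => hM.teacherIter (k + 1)
  refine tendsto_of_tendsto_sum_mul_log (fun _ => zero_le_one)
    (fun k i => ((hT k).row_sum_pos i).le)
    (fun k i h => absurd h ((hT k).row_sum_ne_zero i)) (fun k => ?_) ?_
  · simp [hM.sum_sum_teacherIter_succ k]
  · simpa using tendsto_sum_log_row_teacherIter_succ hM hP hPM

theorem exists_subseq_tendsto_teacherIter_succ (hM : HasPosMarginals M)
    (hP : P ∈ doublyStochastic ℝ ι) (hPM : ∀ i j, M i j = 0 → P i j = 0) :
    ∃ A ∈ doublyStochastic ℝ ι, (∀ i j, M i j = 0 → A i j = 0) ∧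
      ∃ φ : ℕ → ℕ, StrictMono φ ∧ Tendsto (fun m => teacherIter M (φ m + 1)) atTop (𝓝 A) := by
  have hcompact : IsCompact
      (Set.univ.pi fun _ : ι => Set.univ.pi fun _ : ι => Set.Icc (0 : ℝ) 1) :=
    isCompact_univ_pi fun _ => isCompact_univ_pi fun _ => isCompact_Icc
  obtain ⟨A, hA, φ, hφ, hlim⟩ := hcompact.tendsto_subseq (X := ι → ι → ℝ)
    (x := fun k => teacherIter M (k + 1)) fun k i _ j _ => hM.teacherIter_succ_mem_Icc k i j
  have hIcc : ∀ i j, A i j ∈ Set.Icc (0 : ℝ) 1 := fun i j =>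
    hA i (Set.mem_univ i) j (Set.mem_univ j)
  have hentry : ∀ i j, Tendsto (fun m => teacherIter M (φ m + 1) i j) atTop (𝓝 (A i j)) :=
    fun i j => (hlim.apply_nhds i).apply_nhds j
  refine ⟨A, mem_doublyStochastic_iff_sum.mpr ⟨fun i j => (hIcc i j).1, fun i => ?_, fun j => ?_⟩,
    fun i j => hM.eq_zero_of_tendsto_teacherIter hlim, φ, hφ, hlim⟩
  · exact tendsto_nhds_unique (tendsto_finsetSum _ fun j _ => hentry i j)
      (((tendsto_row_sum_teacherIter_succ hM hP hPM).apply_nhds i).comp hφ.tendsto_atTop)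
  · refine tendsto_nhds_unique (tendsto_finsetSum _ fun i _ => hentry i j) ?_
    simp only [hM.sum_teacherIter_succ_col, tendsto_const_nhds]

theorem tendsto_teacherIter_of_subseq (hM : HasPosMarginals M)
    (hA : A ∈ doublyStochastic ℝ ι) (hAM : ∀ i j, M i j = 0 → A i j = 0) {φ : ℕ → ℕ}
    (hφ : StrictMono φ) (hlim : Tendsto (fun m => teacherIter M (φ m + 1)) atTop (𝓝 A)) :
    Tendsto (teacherIter M) atTop (𝓝 A) := by
  have hpairing : Tendsto (fun k => logPairing A (teacherIter M (k + 1))) atTop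
      (𝓝 (logPairing A A)) := by
    rw [tendsto_iff_tendsto_subseq_of_monotone
      (monotone_logPairing_teacherIter_succ hM hA hAM) hφ.tendsto_atTop]
    refine tendsto_finsetSum _ fun i _ => tendsto_finsetSum _ fun j _ => ?_
    rcases eq_or_ne (A i j) 0 with h0 | h0
    · simp only [h0, zero_mul, tendsto_const_nhds]
    · exact (((hlim.apply_nhds i).apply_nhds j).log h0).const_mul _
  refine (tendsto_add_atTop_iff_nat 1).mp (tendsto_of_tendsto_logPairing
    (fun i j => nonneg_of_mem_doublyStochastic hA) (fun k => (hM.teacherIter (k + 1)).nonneg)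
    (fun k i j h => hAM i j ((hM.teacherIter_eq_zero_iff (k + 1) i j).mp h)) (fun k => ?_)
    hpairing)
  simp [hM.sum_sum_teacherIter_succ k, sum_row_of_mem_doublyStochastic hA]

theorem exists_tendsto_iter (hM : HasPosMarginals M) (hP : P ∈ doublyStochastic ℝ ι)
    (hPM : ∀ i j, M i j = 0 → P i j = 0) :
    ∃ A ∈ doublyStochastic ℝ ι,
      Tendsto (learnerIter M) atTop (𝓝 A) ∧ Tendsto (teacherIter M) atTop (𝓝 A) := by
  obtain ⟨A, hA, hAM, φ, hφ, hsub⟩ := exists_subseq_tendsto_teacherIter_succ hM hP hPM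
  have hlim := tendsto_teacherIter_of_subseq hM hA hAM hφ hsub
  exact ⟨A, hA, tendsto_learnerIter_of_tendsto_teacherIter
    (sum_row_of_mem_doublyStochastic hA) hlim, hlim⟩

theorem pos_of_tendsto_teacherIter (hM : HasPosMarginals M) (hP : P ∈ doublyStochastic ℝ ι)
    (hPM : ∀ i j, M i j = 0 → P i j = 0) (hlim : Tendsto (teacherIter M) atTop (𝓝 A)) {i j : ι}
    (hij : 0 < P i j) : 0 < A i j := by
  have hTpos : ∀ k, 0 < teacherIter M (k + 1) i j := fun k =>
    ((hM.teacherIter (k + 1)).nonneg i j).lt_of_ne'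
      (mt (hM.teacherIter_eq_zero_iff (k + 1) i j).mp (mt (hPM i j) hij.ne'))
  have hlower : ∀ k, Real.exp (logPairing P (teacherIter M 1) / P i j) ≤
      teacherIter M (k + 1) i j := by
    intro k
    rw [← Real.le_log_iff_exp_le (hTpos k), div_le_iff₀' hij]
    exact (monotone_logPairing_teacherIter_succ hM hP hPM (Nat.zero_le k)).trans
      (logPairing_le_mul_log (fun _ _ => nonneg_of_mem_doublyStochastic hP)
        (hM.teacherIter_succ_mem_Icc k) i j)
  have hentry : Tendsto (fun k => teacherIter M (k + 1) i j) atTop (𝓝 (A i j)) :=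
    ((hlim.comp (tendsto_add_atTop_nat 1)).apply_nhds i).apply_nhds j
  exact (Real.exp_pos _).trans_le (ge_of_tendsto' hentry hlower)

end Convergence

section DoublyStochastic

variable {ι : Type*} [DecidableEq ι] {A M : Matrix ι ι ℝ} {σ : Equiv.Perm ι}

theorem permMatrix_apply_eq_ite (σ : Equiv.Perm ι) (i j : ι) :
    σ.permMatrix ℝ i j = if σ i = j then 1 else 0 := by
  simp [Equiv.Perm.permMatrix, PEquiv.toMatrix_apply, Equiv.toPEquiv_apply, eq_comm]

theorem permMatrix_apply_self (σ : Equiv.Perm ι) (i : ι) : σ.permMatrix ℝ i (σ i) = 1 := by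
  rw [permMatrix_apply_eq_ite, if_pos rfl]

theorem permMatrix_eq_zero_of_forall_apply_pos (hσ : ∀ i, 0 < M i (σ i)) (i j : ι)
    (hij : M i j = 0) : σ.permMatrix ℝ i j = 0 := by
  rw [permMatrix_apply_eq_ite, if_neg]
  rintro rfl
  exact (hσ i).ne' hij

variable [Fintype ι]

theorem eq_permMatrix_of_forall_apply_eq_one (hA : A ∈ doublyStochastic ℝ ι)
    (hσ : ∀ i, A i (σ i) = 1) : A = σ.permMatrix ℝ := by
  ext i j
  rw [permMatrix_apply_eq_ite]
  split_ifs with hij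
  · exact hij ▸ hσ i
  · have hrest : ∑ j ∈ Finset.univ.erase (σ i), A i j = 0 := by
      have hrow := sum_row_of_mem_doublyStochastic hA i
      rwa [← Finset.add_sum_erase _ _ (Finset.mem_univ (σ i)), hσ i, add_eq_left] at hrow
    exact (Finset.sum_eq_zero_iff_of_nonneg fun _ _ => nonneg_of_mem_doublyStochastic hA).mp hrest
      j (Finset.mem_erase.mpr ⟨Ne.symm hij, Finset.mem_univ j⟩)

theorem apply_pos_of_weight_ne_zero {w : Equiv.Perm ι → ℝ} (hw : ∀ σ, 0 ≤ w σ)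
    (hwA : ∑ σ, w σ • σ.permMatrix ℝ = A) (hσ : w σ ≠ 0) (i : ι) : 0 < A i (σ i) := by
  calc 0 < w σ := (hw σ).lt_of_ne' hσ
    _ = (w σ • σ.permMatrix ℝ) i (σ i) := by
      rw [Matrix.smul_apply, permMatrix_apply_self, smul_eq_mul, mul_one]
    _ ≤ ∑ π, (w π • π.permMatrix ℝ) i (σ i) :=
      Finset.single_le_sum (f := fun π => (w π • π.permMatrix ℝ) i (σ i))
        (fun π _ => mul_nonneg (hw π)
          (nonneg_of_mem_doublyStochastic permMatrix_mem_doublyStochastic)) (Finset.mem_univ σ)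
    _ = A i (σ i) := by rw [← hwA, Matrix.sum_apply]

theorem exists_perm_forall_apply_pos (hA : A ∈ doublyStochastic ℝ ι) :
    ∃ σ : Equiv.Perm ι, ∀ i, 0 < A i (σ i) := by
  obtain ⟨w, hw, hw_sum, hwA⟩ := exists_eq_sum_perm_of_mem_doublyStochastic hA
  obtain ⟨σ, -, hσ⟩ := Finset.exists_ne_zero_of_sum_ne_zero (hw_sum.trans_ne one_ne_zero)
  exact ⟨σ, apply_pos_of_weight_ne_zero hw hwA hσ⟩

theorem existsUnique_forall_apply_pos_iff (hA : A ∈ doublyStochastic ℝ ι) :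
    (∃! σ : Equiv.Perm ι, ∀ i, 0 < A i (σ i)) ↔ ∃ σ : Equiv.Perm ι, A = σ.permMatrix ℝ := by
  constructor
  · rintro ⟨σ, -, huniq⟩
    obtain ⟨w, hw, hw_sum, hwA⟩ := exists_eq_sum_perm_of_mem_doublyStochastic hA
    have hzero : ∀ τ ≠ σ, w τ = 0 := fun τ hτ => by_contra fun hne =>
      hτ (huniq τ (apply_pos_of_weight_ne_zero hw hwA hne))
    rw [Fintype.sum_eq_single σ hzero] at hw_sum
    rw [Fintype.sum_eq_single σ fun τ hτ => by rw [hzero τ hτ, zero_smul], hw_sum, one_smul] at hwA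
    exact ⟨σ, hwA.symm⟩
  · rintro ⟨σ, rfl⟩
    refine ⟨σ, fun i => permMatrix_apply_self σ i ▸ one_pos, fun τ hτ => Equiv.ext fun i => ?_⟩
    by_contra hne
    exact (hτ i).ne' (by rw [permMatrix_apply_eq_ite, if_neg (Ne.symm hne)])

theorem forall_eq_zero_or_eq_one_iff_exists_eq_permMatrix (hA : A ∈ doublyStochastic ℝ ι) :
    (∀ i j, A i j = 0 ∨ A i j = 1) ↔ ∃ σ : Equiv.Perm ι, A = σ.permMatrix ℝ := by
  constructor
  · intro h
    obtain ⟨σ, hσ⟩ := exists_perm_forall_apply_pos hA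
    exact ⟨σ, eq_permMatrix_of_forall_apply_eq_one hA fun i =>
      (h i (σ i)).resolve_left (hσ i).ne'⟩
  · rintro ⟨σ, rfl⟩ i j
    rw [permMatrix_apply_eq_ite]
    exact (ite_eq_or_eq _ _ _).symm

theorem transmissionIndex_self_eq_one_iff_forall [Nonempty ι] (hA : A ∈ doublyStochastic ℝ ι) :
    transmissionIndex A A = 1 ↔ ∀ i j, A i j = 0 ∨ A i j = 1 := by
  have hnonneg : ∀ i j, 0 ≤ A i j * (1 - A i j) := fun i j =>
    mul_nonneg (nonneg_of_mem_doublyStochastic hA)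
      (sub_nonneg.mpr (le_one_of_mem_doublyStochastic hA))
  have hdeficit : ∑ j, ∑ i, A i j * (1 - A i j) = Fintype.card ι - ∑ j, ∑ i, A i j * A i j := by
    simp [mul_sub, sum_col_of_mem_doublyStochastic hA]
  calc transmissionIndex A A = 1
      ↔ ∑ j, ∑ i, A i j * A i j = Fintype.card ι := by
        rw [transmissionIndex, one_div, inv_mul_eq_one₀ (Nat.cast_ne_zero.mpr Fintype.card_ne_zero),
          eq_comm]
    _ ↔ ∑ j, ∑ i, A i j * (1 - A i j) = 0 := by rw [hdeficit, sub_eq_zero, eq_comm]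
    _ ↔ ∀ i j, A i j * (1 - A i j) = 0 := by
        rw [Finset.sum_comm, Fintype.sum_eq_zero_iff_of_nonneg fun i =>
          Finset.sum_nonneg fun j _ => hnonneg i j, funext_iff]
        exact forall_congr' fun i =>
          (Fintype.sum_eq_zero_iff_of_nonneg (hnonneg i)).trans funext_iff
    _ ↔ ∀ i j, A i j = 0 ∨ A i j = 1 := by
        simp only [mul_eq_zero, sub_eq_zero, eq_comm (a := (1 : ℝ))]

theorem transmissionIndex_self_eq_one_iff_existsUnique [Nonempty ι]
    (hA : A ∈ doublyStochastic ℝ ι) :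
    transmissionIndex A A = 1 ↔ ∃! σ : Equiv.Perm ι, ∀ i, 0 < A i (σ i) := by
  rw [transmissionIndex_self_eq_one_iff_forall hA,
    forall_eq_zero_or_eq_one_iff_exists_eq_permMatrix hA, existsUnique_forall_apply_pos_iff hA]

end DoublyStochastic

theorem forall_apply_pos_iff_of_tendsto_teacherIter {ι : Type*} [Fintype ι]
    {A M : Matrix ι ι ℝ} (hM : HasPosMarginals M) (hlim : Tendsto (teacherIter M) atTop (𝓝 A))
    (σ : Equiv.Perm ι) :
    (∀ i, 0 < A i (σ i)) ↔ ∀ i, 0 < M i (σ i) := by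
  classical
  constructor
  · exact fun hσ i => (hM.nonneg i (σ i)).lt_of_ne' fun h =>
      (hσ i).ne' (hM.eq_zero_of_tendsto_teacherIter (φ := id) hlim h)
  · exact fun hσ i => pos_of_tendsto_teacherIter hM permMatrix_mem_doublyStochastic
      (permMatrix_eq_zero_of_forall_apply_pos hσ) hlim (permMatrix_apply_self σ i ▸ one_pos)

end CoopInf

open CoopInf

theorem theorem2 (n : ℕ) (hn : 1 ≤ n) (M : Matrix (Fin n) (Fin n) ℝ)
    (hM : ∀ i j, 0 ≤ M i j)
    (hdiag : ∃ σ : Equiv.Perm (Fin n), CoopInf.IsPositiveDiagonal M σ) :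
    CoopInf.IterConverges M ∧
      List.TFAE [
        CoopInf.cooperativeIndex M = 1,
        ∃! σ : Equiv.Perm (Fin n), CoopInf.IsPositiveDiagonal M σ,
        ∃ U : Matrix (Fin n) (Fin n) ℝ,
          CoopInf.IsPosUpperTriangular U ∧ CoopInf.IsPermutationOf M U] := by
  have : Nonempty (Fin n) := Fin.pos_iff_nonempty.mp hn
  obtain ⟨σ, hσ⟩ := hdiag
  have hσM := permMatrix_eq_zero_of_forall_apply_pos hσ
  have hpos := HasPosMarginals.of_mem_doublyStochastic hM permMatrix_mem_doublyStochastic hσM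
  obtain ⟨A, hA, hL, hT⟩ := exists_tendsto_iter hpos permMatrix_mem_doublyStochastic hσM
  have hCI : cooperativeIndex M = transmissionIndex A A := by
    rw [cooperativeIndex, hL.limUnder_eq, hT.limUnder_eq]
  refine ⟨⟨⟨A, hL⟩, A, hT⟩, ?_⟩
  tfae_have 1 ↔ 2 := by
    rw [hCI, transmissionIndex_self_eq_one_iff_existsUnique hA]
    exact existsUnique_congr (forall_apply_pos_iff_of_tendsto_teacherIter hpos hT)
  tfae_have 2 → 3 := exists_isPermutationOf_isPosUpperTriangular hM
  tfae_have 3 → 2 := fun ⟨_, hU, hMU⟩ => hU.existsUnique_isPositiveDiagonal hMU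
  tfae_finish
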